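/- Let $V=\mathbb C^n$ with $n\ge 0$, let $\underline V=V\oplus\mathbb C\eta$, let $r\ge 1$, and let $T=\underline V^{\otimes r}$. Let $\Phi$ be the diagonal action of $\mathrm{GL}(\underline V)$ on $T$ and let $\Psi$ be the permutation action of the symmetric group $\mathfrak S_r$ on $T$, $\Psi(\sigma)(v_1\otimes\cdots\otimes v_r)=v_{\sigma^{-1}(1)}\otimes\cdots\otimes v_{\sigma^{-1}(r)}$. For $g\in\mathrm{GL}(V)$ and $v\in V$ let $(g,v)\in\mathrm{GL}(\underline V)$ be the map $u+a\eta\mapsto gu+av+a\eta$; these maps form the enhanced group $\underline G$, and we write $e^v=(\mathrm{id},v)$. Let $\mathbb G_m=\mathbb C^\times$ act on $\underline V$ by $c\cdot(u+a\eta)=u+ca\eta$. The parabolic Schur algebra $\mathcal P(n,r)\subset\mathrm{End}_{\mathbb C}(T)$ is the subalgebra generated by $\Phi(\underline G\rtimes\mathbb G_m)$, where $\underline G\rtimes\mathbb G_m$ is the subgroup of $\mathrm{GL}(\underline V)$ generated by $\underline G$ and $\mathbb G_m$. Let $\mathbb C\Psi(\mathfrak S_r)$ be the subalgebra of $\mathrm{End}_{\mathbb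 C}(T)$ generated by $\Psi(\mathfrak S_r)$. The degenerate double Hecke algebra $\mathcal H_r$ is the unital associative $\mathbb C$-algebra with generators $\mathbf s_i$ ($1\le i\le r-1$) and $\mathbf x^{(l)}_\sigma$ ($0\le l\le r$, $\sigma\in\mathfrak S_l$) and with the relations $$\mathbf s_i^2=1,\qquad \mathbf s_i\mathbf s_j=\mathbf s_j\mathbf s_i\ (|i-j|>1),\qquad \mathbf s_i\mathbf s_j\mathbf s_i=\mathbf s_j\mathbf s_i\mathbf s_j\ (|i-j|=1),$$ $$\mathbf x^{(l)}_\sigma\mathbf x^{(l)}_\mu=\mathbf x^{(l)}_{\sigma\mu},\qquad \mathbf x^{(l)}_\delta\mathbf x^{(k)}_\gamma=0\ (k\ne l),$$ $$\mathbf s_i\mathbf x^{(l)}_\sigma=\mathbf x^{(l)}_{s_i\sigma},\quad \mathbf x^{(l)}_\sigma\mathbf s_i=\mathbf x^{(l)}_{\sigma s_i}\ (i<l),\qquad \mathbf s_i\mathbf x^{(l)}_\sigma=\mathbf x^{(l)}_\sigma=\mathbf x^{(l)}_\sigma\mathbf s_i\ (i>l),$$ where $s_i=(i,i+1)$. For $I\subseteq\{1,\dots,r\}$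 let $T_I\subseteq T$ be the span of the pure tensors whose $k$-th factor lies in $V$ for $k\in I$ and in $\mathbb C\eta$ for $k\notin I$, so that $T=\bigoplus_I T_I$. The representation $\Xi$ of $\mathcal H_r$ on $T$ sends $\mathbf s_i$ to $\Psi(s_i)$ and $\mathbf x^{(l)}_\sigma$ to the operator that permutes the first $l$ tensor factors by $\sigma$ on $T_{\{1,\dots,l\}}=V^{\otimes l}\otimes\eta^{\otimes(r-l)}$ and annihilates $T_I$ for every other $I$. Put $D(n,r)=\Xi(\mathcal H_r)$ and $$D(n,r)^V=\{\varphi\in D(n,r)\mid \Phi(e^v)\,\varphi\,\Phi(e^{-v})=\varphi\ \text{ for all } v\in V\}.$$ **Proposition.** Assume $D(n,r)^V=\mathbb C\Psi(\mathfrak S_r)$. Then the center of $\mathcal P(n,r)$ is one-dimensional, and it consists of the scalars $\mathbb C\cdot\mathrm{id}$. -/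

import Mathlib

open scoped TensorProduct

noncomputable section

namespace ParabolicSchur

/-- `V = ℂⁿ`. -/
abbrev V (n : ℕ) : Type := Fin n → ℂ

/-- The enhanced space `V ⊕ ℂη`; the pair `(u, a)` stands for `u + a η`. -/
abbrev EV (n : ℕ) : Type := V n × ℂ

/-- The `r`-th tensor power of the enhanced space. -/
abbrev T (n r : ℕ) : Type := ⨂[ℂ] _k : Fin r, EV n

/-! ### The groups -/

/-- The action of `(g, v)` on the enhanced space, `u + a η ↦ g u + a v + a η`. -/
def enh {n : ℕ} (g : LinearMap.GeneralLinearGroup ℂ (V n)) (v : V n) :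
    LinearMap.GeneralLinearGroup ℂ (EV n) where
  val := (((g : V n →ₗ[ℂ] V n).comp (LinearMap.fst ℂ (V n) ℂ)) +
    (LinearMap.snd ℂ (V n) ℂ).smulRight v).prod (LinearMap.snd ℂ (V n) ℂ)
  inv := ((((g⁻¹ : LinearMap.GeneralLinearGroup ℂ (V n)) : V n →ₗ[ℂ] V n).comp
      (LinearMap.fst ℂ (V n) ℂ)) +
    (LinearMap.snd ℂ (V n) ℂ).smulRight
      (-((g⁻¹ : LinearMap.GeneralLinearGroup ℂ (V n)) : V n →ₗ[ℂ] V n) v)).prod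
      (LinearMap.snd ℂ (V n) ℂ)
  val_inv := by
    refine LinearMap.ext fun x => ?_
    have h : ∀ y : V n, (g : V n →ₗ[ℂ] V n)
        (((g⁻¹ : LinearMap.GeneralLinearGroup ℂ (V n)) : V n →ₗ[ℂ] V n) y) = y := fun y => by
      rw [← Module.End.mul_apply, Units.mul_inv]; rfl
    refine Prod.ext ?_ ?_ <;> simp [h]
  inv_val := by
    refine LinearMap.ext fun x => ?_
    have h : ∀ y : V n, ((g⁻¹ : LinearMap.GeneralLinearGroup ℂ (V n)) : V n →ₗ[ℂ] V n)
        ((g : V n →ₗ[ℂ] V n) y) = y := fun y => by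
      rw [← Module.End.mul_apply, Units.inv_mul]; rfl
    refine Prod.ext ?_ ?_ <;> simp [h]

theorem enh_apply {n : ℕ} (g : LinearMap.GeneralLinearGroup ℂ (V n)) (v u : V n) (a : ℂ) :
    (enh g v : EV n →ₗ[ℂ] EV n) (u, a) = ((g : V n →ₗ[ℂ] V n) u + a • v, a) := rfl

theorem enh_mul {n : ℕ} (g h : LinearMap.GeneralLinearGroup ℂ (V n)) (v w : V n) :
    enh g v * enh h w = enh (g * h) ((g : V n →ₗ[ℂ] V n) w + v) := by
  refine Units.ext (LinearMap.ext fun x => ?_)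
  obtain ⟨u, a⟩ := x
  rw [Units.val_mul, Module.End.mul_apply, enh_apply, enh_apply, enh_apply]
  simp [add_assoc]

theorem enh_one {n : ℕ} : enh (1 : LinearMap.GeneralLinearGroup ℂ (V n)) 0 = 1 := by
  refine Units.ext (LinearMap.ext fun x => ?_)
  obtain ⟨u, a⟩ := x
  rw [enh_apply]
  simp

/-- The enhanced group `GL(V) ×_ν V`, as a subgroup of `GL(V ⊕ ℂη)`. -/
def enhancedGroup (n : ℕ) : Subgroup (LinearMap.GeneralLinearGroup ℂ (EV n)) where
  carrier := {x | ∃ g v, x = enh g v}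
  mul_mem' := by
    rintro _ _ ⟨g, v, rfl⟩ ⟨h, w, rfl⟩
    exact ⟨_, _, enh_mul g h v w⟩
  one_mem' := ⟨1, 0, enh_one.symm⟩
  inv_mem' := by
    rintro _ ⟨g, v, rfl⟩
    refine ⟨g⁻¹, -((g⁻¹ : LinearMap.GeneralLinearGroup ℂ (V n)) : V n →ₗ[ℂ] V n) v, ?_⟩
    rw [inv_eq_iff_mul_eq_one, enh_mul, mul_inv_cancel, map_neg, ← Module.End.mul_apply,
      Units.mul_inv, Module.End.one_apply, neg_add_cancel, enh_one]

/-- The embedding `c ↦ diag(1, …, 1, c)` of `𝔾ₘ` in `GL(V ⊕ ℂη)`: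
`u + a η ↦ u + c a η`. -/
def torus (n : ℕ) : ℂˣ →* LinearMap.GeneralLinearGroup ℂ (EV n) where
  toFun c :=
    { val := LinearMap.prodMap LinearMap.id ((c : ℂ) • LinearMap.id)
      inv := LinearMap.prodMap LinearMap.id (((c⁻¹ : ℂˣ) : ℂ) • LinearMap.id)
      val_inv := by
        refine LinearMap.ext fun x => Prod.ext ?_ ?_ <;> simp
      inv_val := by
        refine LinearMap.ext fun x => Prod.ext ?_ ?_ <;> simp }
  map_one' := by
    refine Units.ext (LinearMap.ext fun x => Prod.ext ?_ ?_) <;> simp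
  map_mul' c d := by
    refine Units.ext (LinearMap.ext fun x => Prod.ext ?_ ?_) <;> simp [mul_assoc]

/-- The parabolic subgroup generated by the enhanced group and by `𝔾ₘ`. -/
def parabolicGroup (n : ℕ) : Subgroup (LinearMap.GeneralLinearGroup ℂ (EV n)) :=
  enhancedGroup n ⊔ (torus n).range

/-! ### The representations of `GL(V ⊕ ℂη)` and of `𝔖_r` on the tensor power -/

/-- The diagonal action of `GL(V ⊕ ℂη)`. -/
def Phi (n r : ℕ) : LinearMap.GeneralLinearGroup ℂ (EV n) →* Module.End ℂ (T n r) where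
  toFun g := PiTensorProduct.map fun _ => (g : EV n →ₗ[ℂ] EV n)
  map_one' := PiTensorProduct.map_one
  map_mul' g h := PiTensorProduct.map_mul (fun _ => (g : EV n →ₗ[ℂ] EV n))
    (fun _ => (h : EV n →ₗ[ℂ] EV n))

/-- The permutation of the tensor factors by `σ`. -/
def psi (n r : ℕ) (σ : Equiv.Perm (Fin r)) : Module.End ℂ (T n r) :=
  (PiTensorProduct.reindex ℂ (fun _ => EV n) σ).toLinearMap

theorem psi_tprod {n r : ℕ} (σ : Equiv.Perm (Fin r)) (f : Fin r → EV n) :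
    psi n r σ (PiTensorProduct.tprod ℂ f) =
      PiTensorProduct.tprod ℂ (fun k => f (σ⁻¹ k)) :=
  PiTensorProduct.reindex_tprod σ f

/-- The permutation representation
`Ψ(σ)(v₁ ⊗ ⋯ ⊗ v_r) = v_{σ⁻¹(1)} ⊗ ⋯ ⊗ v_{σ⁻¹(r)}` of `𝔖_r`. -/
def Psi (n r : ℕ) : Equiv.Perm (Fin r) →* Module.End ℂ (T n r) where
  toFun := psi n r
  map_one' := by
    refine PiTensorProduct.ext (MultilinearMap.ext fun f => ?_)
    simp [psi_tprod]
  map_mul' σ τ := by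
    refine PiTensorProduct.ext (MultilinearMap.ext fun f => ?_)
    simp [psi_tprod, Module.End.mul_apply]

theorem Psi_tprod {n r : ℕ} (σ : Equiv.Perm (Fin r)) (f : Fin r → EV n) :
    Psi n r σ (PiTensorProduct.tprod ℂ f) =
      PiTensorProduct.tprod ℂ (fun k => f (σ⁻¹ k)) :=
  psi_tprod σ f

/-- The parabolic Schur algebra: the subalgebra generated by the image of the parabolic group. -/
def parabolicSchurAlgebra (n r : ℕ) : Subalgebra ℂ (Module.End ℂ (T n r)) :=
  Algebra.adjoin ℂ (Phi n r '' (parabolicGroup n : Set (LinearMap.GeneralLinearGroup ℂ (EV n))))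

/-- The subalgebra `ℂΨ(𝔖_r)` generated by the image of `𝔖_r`. -/
def symmetricImage (n r : ℕ) : Subalgebra ℂ (Module.End ℂ (T n r)) :=
  Algebra.adjoin ℂ (Set.range (Psi n r))

/-! ### The degenerate double Hecke algebra

Positions are numbered from `0`: the generator `s j` belongs to the transposition of the positions
`j` and `j + 1`, so that it is the generator with index `j + 1` when one numbers from `1`. -/

/-- The transposition of `j` and `j + 1` in the symmetric group on `m` letters. -/
def adjSwap (m j : ℕ) (h : j + 1 < m) : Equiv.Perm (Fin m) :=
  Equiv.swap ⟨j, Nat.lt_of_succ_lt h⟩ ⟨j + 1, h⟩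

/-- Generators `s_j` and `x_σ^{(l)}`, `σ ∈ 𝔖_l`, `0 ≤ l ≤ r`. -/
inductive Gen (r : ℕ) : Type
  | s (j : ℕ) (h : j + 1 < r) : Gen r
  | x (l : ℕ) (h : l ≤ r) (σ : Equiv.Perm (Fin l)) : Gen r

/-- The generator `s_j` in the free algebra. -/
def fs {r : ℕ} (j : ℕ) (h : j + 1 < r) : FreeAlgebra ℂ (Gen r) :=
  FreeAlgebra.ι ℂ (Gen.s j h)

/-- The generator `x_σ^{(l)}` in the free algebra. -/
def fx {r : ℕ} (l : ℕ) (h : l ≤ r) (σ : Equiv.Perm (Fin l)) : FreeAlgebra ℂ (Gen r) :=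
  FreeAlgebra.ι ℂ (Gen.x l h σ)

/-- The defining relations of the degenerate double Hecke algebra. -/
inductive Rel (r : ℕ) : FreeAlgebra ℂ (Gen r) → FreeAlgebra ℂ (Gen r) → Prop
  | s_sq (j : ℕ) (h : j + 1 < r) : Rel r (fs j h * fs j h) 1
  | s_comm (i j : ℕ) (hi : i + 1 < r) (hj : j + 1 < r) (hij : i + 1 < j) :
      Rel r (fs i hi * fs j hj) (fs j hj * fs i hi)
  | s_braid (j : ℕ) (hj : j + 1 < r) (hj' : j + 1 + 1 < r) :
      Rel r (fs j hj * fs (j + 1) hj' * fs j hj)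
        (fs (j + 1) hj' * fs j hj * fs (j + 1) hj')
  | x_mul (l : ℕ) (hl : l ≤ r) (σ μ : Equiv.Perm (Fin l)) :
      Rel r (fx l hl σ * fx l hl μ) (fx l hl (σ * μ))
  | s_x_of_lt (l : ℕ) (hl : l ≤ r) (σ : Equiv.Perm (Fin l)) (j : ℕ) (hj : j + 1 < r)
      (hjl : j + 1 < l) :
      Rel r (fs j hj * fx l hl σ) (fx l hl (adjSwap l j hjl * σ))
  | x_s_of_lt (l : ℕ) (hl : l ≤ r) (σ : Equiv.Perm (Fin l)) (j : ℕ) (hj : j + 1 < r)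
      (hjl : j + 1 < l) :
      Rel r (fx l hl σ * fs j hj) (fx l hl (σ * adjSwap l j hjl))
  | s_x_of_gt (l : ℕ) (hl : l ≤ r) (σ : Equiv.Perm (Fin l)) (j : ℕ) (hj : j + 1 < r)
      (hlj : l < j + 1) :
      Rel r (fs j hj * fx l hl σ) (fx l hl σ)
  | x_s_of_gt (l : ℕ) (hl : l ≤ r) (σ : Equiv.Perm (Fin l)) (j : ℕ) (hj : j + 1 < r)
      (hlj : l < j + 1) :
      Rel r (fx l hl σ * fs j hj) (fx l hl σ)
  | x_mul_of_ne (l k : ℕ) (hl : l ≤ r) (hk : k ≤ r) (hkl : k ≠ l) (δ : Equiv.Perm (Fin l))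
      (γ : Equiv.Perm (Fin k)) :
      Rel r (fx l hl δ * fx k hk γ) 0

/-- The degenerate double Hecke algebra `ℋ_r`. -/
abbrev DDHA (r : ℕ) : Type := RingQuot (Rel r)

/-! ### Its representation on the tensor power -/

/-- The projection `u + a η ↦ u` of the enhanced space to `V`. -/
def projV (n : ℕ) : EV n →ₗ[ℂ] EV n :=
  (LinearMap.inl ℂ (V n) ℂ).comp (LinearMap.fst ℂ (V n) ℂ)

/-- The projection `u + a η ↦ a η` of the enhanced space to `ℂη`. -/
def projEta (n : ℕ) : EV n →ₗ[ℂ] EV n :=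
  (LinearMap.inr ℂ (V n) ℂ).comp (LinearMap.snd ℂ (V n) ℂ)

/-- The factor at the position `k` of the projection to `V^{⊗ l} ⊗ η^{⊗ (r - l)}`. -/
def blockFactor (n l k : ℕ) : EV n →ₗ[ℂ] EV n := if k < l then projV n else projEta n

/-- The projection of the tensor power of `V ⊕ ℂη` to its summand `V^{⊗ l} ⊗ η^{⊗ (r - l)}` that
annihilates every other summand (a summand consists of the tensors with factors in `V` at a given
set `I` of positions and factors in `ℂη` at the others). -/
def blockProj (n r l : ℕ) : Module.End ℂ (T n r) :=
  PiTensorProduct.map fun k : Fin r => blockFactor n l k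

/-- The embedding `𝔖_l → 𝔖_r` for `l ≤ r`: a permutation of the first `l` positions fixes the
others. -/
def permExt {l r : ℕ} (h : l ≤ r) : Equiv.Perm (Fin l) →* Equiv.Perm (Fin r) :=
  Equiv.Perm.viaEmbeddingHom (Fin.castLEEmb h)

/-- The operator that permutes the first `l` factors on the summand `V^{⊗ l} ⊗ η^{⊗ (r - l)}` by
`σ ∈ 𝔖_l` and annihilates every other summand. -/
def xOp (n r l : ℕ) (h : l ≤ r) (σ : Equiv.Perm (Fin l)) : Module.End ℂ (T n r) :=
  Psi n r (permExt h σ) * blockProj n r l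

theorem permExt_apply_of_lt {l r : ℕ} (h : l ≤ r) (σ : Equiv.Perm (Fin l)) (k : Fin r)
    (hk : (k : ℕ) < l) : permExt h σ k = Fin.castLE h (σ ⟨k, hk⟩) :=
  Equiv.Perm.viaEmbedding_apply σ (Fin.castLEEmb h) ⟨k, hk⟩

theorem permExt_apply_of_ge {l r : ℕ} (h : l ≤ r) (σ : Equiv.Perm (Fin l)) (k : Fin r)
    (hk : l ≤ (k : ℕ)) : permExt h σ k = k := by
  refine Equiv.Perm.viaEmbedding_apply_of_notMem σ (Fin.castLEEmb h) k ?_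
  rintro ⟨i, rfl⟩
  exact absurd i.isLt (not_lt.mpr hk)

theorem permExt_lt_iff {l r : ℕ} (h : l ≤ r) (σ : Equiv.Perm (Fin l)) (k : Fin r) :
    ((permExt h σ k : Fin r) : ℕ) < l ↔ (k : ℕ) < l := by
  by_cases hk : (k : ℕ) < l
  · rw [permExt_apply_of_lt h σ k hk]
    simp [hk]
  · rw [permExt_apply_of_ge h σ k (not_lt.mp hk)]

theorem permExt_adjSwap {l r : ℕ} (h : l ≤ r) (j : ℕ) (hj : j + 1 < r) (hjl : j + 1 < l) :
    permExt h (adjSwap l j hjl) = adjSwap r j hj := by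
  refine Equiv.ext fun k => ?_
  by_cases hk : (k : ℕ) < l
  · rw [permExt_apply_of_lt h _ k hk]
    apply Fin.ext
    simp only [adjSwap, Equiv.swap_apply_def, Fin.val_castLE, Fin.ext_iff]
    split_ifs <;> rfl
  · rw [permExt_apply_of_ge h _ k (not_lt.mp hk), adjSwap, Equiv.swap_apply_of_ne_of_ne]
    · intro e
      have := congrArg Fin.val e
      simp only at this
      omega
    · intro e
      have := congrArg Fin.val e
      simp only at this
      omega

theorem blockProj_tprod {n r : ℕ} (l : ℕ) (f : Fin r → EV n) :
    blockProj n r l (PiTensorProduct.tprod ℂ f) =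
      PiTensorProduct.tprod ℂ (fun k : Fin r => blockFactor n l k (f k)) :=
  PiTensorProduct.map_tprod _ f

theorem blockFactor_idem (n l k : ℕ) (x : EV n) :
    blockFactor n l k (blockFactor n l k x) = blockFactor n l k x := by
  unfold blockFactor
  split_ifs <;> simp [projV, projEta]

theorem blockProj_idem (n r l : ℕ) : blockProj n r l * blockProj n r l = blockProj n r l := by
  refine PiTensorProduct.ext (MultilinearMap.ext fun f => ?_)
  simp [Module.End.mul_apply, blockProj_tprod, blockFactor_idem]

theorem blockProj_mul_of_ne (n r l k : ℕ) (hl : l ≤ r) (hk : k ≤ r) (h : k ≠ l) :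
    blockProj n r l * blockProj n r k = 0 := by
  refine PiTensorProduct.ext (MultilinearMap.ext fun f => ?_)
  have hmr : min k l < r := by omega
  simp only [Module.End.mul_apply, blockProj_tprod, LinearMap.compMultilinearMap_apply,
    LinearMap.zero_apply]
  refine MultilinearMap.map_coord_zero (PiTensorProduct.tprod ℂ)
    (⟨min k l, hmr⟩ : Fin r) ?_
  rcases lt_or_gt_of_ne h with h' | h'
  · simp [blockFactor, projV, projEta, min_eq_left h'.le, h']
  · simp [blockFactor, projV, projEta, min_eq_right h'.le, h']

/-- A permutation of the positions that preserves the first `l` commutes with the projection. -/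
theorem Psi_mul_blockProj {n r : ℕ} (l : ℕ) (τ : Equiv.Perm (Fin r))
    (hτ : ∀ k : Fin r, ((τ k : Fin r) : ℕ) < l ↔ (k : ℕ) < l) :
    Psi n r τ * blockProj n r l = blockProj n r l * Psi n r τ := by
  refine PiTensorProduct.ext (MultilinearMap.ext fun f => ?_)
  simp only [Module.End.mul_apply, blockProj_tprod, LinearMap.compMultilinearMap_apply, Psi_tprod]
  congr 1
  funext k
  have hap : τ (τ⁻¹ k) = k := Equiv.apply_symm_apply τ k
  have h : (((τ⁻¹ k : Fin r) : ℕ) < l) ↔ ((k : ℕ) < l) := by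
    rw [← hτ (τ⁻¹ k), hap]
  simp only [blockFactor, h]

/-- A permutation that fixes the first `l` positions acts trivially on
`V^{⊗ l} ⊗ η^{⊗ (r - l)}`. -/
theorem Psi_mul_blockProj_of_fix {n r : ℕ} (l : ℕ) (τ : Equiv.Perm (Fin r))
    (hτ : ∀ k : Fin r, (k : ℕ) < l → τ k = k) :
    Psi n r τ * blockProj n r l = blockProj n r l := by
  have hinv : ∀ k : Fin r, (k : ℕ) < l → τ⁻¹ k = k := fun k hk => by
    rw [Equiv.Perm.inv_eq_iff_eq, hτ k hk]
  have hge : ∀ k : Fin r, ¬ (k : ℕ) < l → ¬ ((τ⁻¹ k : Fin r) : ℕ) < l := fun k hk h => by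
    have h2 := hτ _ h
    rw [show τ (τ⁻¹ k) = k from Equiv.apply_symm_apply τ k] at h2
    rw [← h2] at h
    exact hk h
  refine PiTensorProduct.ext (MultilinearMap.ext fun f => ?_)
  simp only [Module.End.mul_apply, blockProj_tprod, LinearMap.compMultilinearMap_apply, Psi_tprod]
  let c : Fin r → ℂ := fun k => if (k : ℕ) < l then 1 else (f k).2
  let w : Fin r → EV n := fun k => if (k : ℕ) < l then projV n (f k) else (0, 1)
  have e1 : (fun k : Fin r => blockFactor n l k (f k)) = fun k => c k • w k := by
    funext k
    by_cases hk : (k : ℕ) < l <;> simp [blockFactor, c, w, hk, projEta]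
  have e2 : (fun k : Fin r => blockFactor n l (τ⁻¹ k : Fin r) (f (τ⁻¹ k))) =
      fun k => c (τ⁻¹ k) • w k := by
    funext k
    refine (congrFun e1 (τ⁻¹ k)).trans ?_
    congr 1
    by_cases hk : (k : ℕ) < l
    · rw [hinv k hk]
    · change (if ((τ⁻¹ k : Fin r) : ℕ) < l then _ else _) = (if (k : ℕ) < l then _ else _)
      rw [if_neg hk, if_neg (hge k hk)]
  rw [e1, e2, MultilinearMap.map_smul_univ, MultilinearMap.map_smul_univ]
  congr 1
  exact Equiv.prod_comp τ⁻¹ c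

theorem adjSwap_of_gt {r : ℕ} (l j : ℕ) (hj : j + 1 < r) (hlj : l < j + 1) (k : Fin r)
    (hk : (k : ℕ) < l) : adjSwap r j hj k = k := by
  rw [adjSwap, Equiv.swap_apply_of_ne_of_ne]
  · intro e
    have := congrArg Fin.val e
    simp only at this
    omega
  · intro e
    have := congrArg Fin.val e
    simp only at this
    omega

/-- The values of `Ξ` on the generators. -/
def genOp (n r : ℕ) : Gen r → Module.End ℂ (T n r)
  | Gen.s j h => Psi n r (adjSwap r j h)
  | Gen.x l h σ => xOp n r l h σ

theorem Psi_permExt_comm {n r l : ℕ} (h : l ≤ r) (σ : Equiv.Perm (Fin l)) :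
    Psi n r (permExt h σ) * blockProj n r l = blockProj n r l * Psi n r (permExt h σ) :=
  Psi_mul_blockProj l _ (permExt_lt_iff h σ)

theorem genOp_rel (n r : ℕ) ⦃a b : FreeAlgebra ℂ (Gen r)⦄ (hab : Rel r a b) :
    FreeAlgebra.lift ℂ (genOp n r) a = FreeAlgebra.lift ℂ (genOp n r) b := by
  cases hab with
  | s_sq j h =>
    simp only [fs, map_mul, map_one, FreeAlgebra.lift_ι_apply, genOp]
    rw [← map_mul, adjSwap, Equiv.swap_mul_self, map_one]
  | s_comm i j hi hj hij =>
    simp only [fs, map_mul, FreeAlgebra.lift_ι_apply, genOp]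
    rw [← map_mul, ← map_mul]
    congr 1
    apply Equiv.Perm.Disjoint.commute
    intro k
    simp only [adjSwap, Equiv.swap_apply_def, Fin.ext_iff]
    by_cases h1 : (k : ℕ) = i
    · right
      rw [if_neg (by omega), if_neg (by omega)]
    · by_cases h2 : (k : ℕ) = i + 1
      · right
        rw [if_neg (by omega), if_neg (by omega)]
      · left
        rw [if_neg h1, if_neg h2]
  | s_braid j hj hj' =>
    simp only [fs, map_mul, FreeAlgebra.lift_ι_apply, genOp]
    rw [← map_mul, ← map_mul, ← map_mul, ← map_mul]
    congr 1
    simp only [adjSwap]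
    rw [Equiv.swap_mul_swap_mul_swap (by simp) (by simp; omega), Equiv.swap_comm _ (⟨j + 1, hj⟩ : Fin r),
      Equiv.swap_comm _ (⟨j + 1 + 1, hj'⟩ : Fin r),
      Equiv.swap_mul_swap_mul_swap (by simp) (by simp; omega), Equiv.swap_comm]
  | x_mul l hl σ μ =>
    simp only [fx, map_mul, FreeAlgebra.lift_ι_apply, genOp, xOp]
    rw [mul_assoc, ← mul_assoc (blockProj n r l), ← Psi_permExt_comm hl μ, mul_assoc,
      blockProj_idem, mul_assoc]
  | s_x_of_lt l hl σ j hj hjl =>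
    simp only [fs, fx, map_mul, FreeAlgebra.lift_ι_apply, genOp, xOp]
    rw [permExt_adjSwap hl j hj hjl, mul_assoc]
  | x_s_of_lt l hl σ j hj hjl =>
    simp only [fs, fx, map_mul, FreeAlgebra.lift_ι_apply, genOp, xOp]
    rw [← permExt_adjSwap hl j hj hjl, mul_assoc, mul_assoc, Psi_permExt_comm]
  | s_x_of_gt l hl σ j hj hlj =>
    simp only [fs, fx, map_mul, FreeAlgebra.lift_ι_apply, genOp, xOp]
    rw [Psi_permExt_comm, ← mul_assoc,
      Psi_mul_blockProj_of_fix l _ (adjSwap_of_gt l j hj hlj)]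
  | x_s_of_gt l hl σ j hj hlj =>
    simp only [fs, fx, map_mul, FreeAlgebra.lift_ι_apply, genOp, xOp]
    have hfix := adjSwap_of_gt l j hj hlj
    have hlt : ∀ k : Fin r, ((adjSwap r j hj k : Fin r) : ℕ) < l ↔ (k : ℕ) < l := by
      intro k
      refine ⟨fun h => ?_, fun h => by rw [hfix k h]; exact h⟩
      have h2 := hfix _ h
      rw [(adjSwap r j hj).injective h2] at h
      exact h
    rw [mul_assoc, ← Psi_mul_blockProj l _ hlt, Psi_mul_blockProj_of_fix l _ hfix]
  | x_mul_of_ne l k hl hk hkl δ γ =>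
    simp only [fx, map_mul, map_zero, FreeAlgebra.lift_ι_apply, genOp, xOp]
    rw [Psi_permExt_comm hk γ, mul_assoc, ← mul_assoc (blockProj n r l),
      blockProj_mul_of_ne n r l k hl hk hkl, zero_mul, mul_zero]

/-- The representation `Ξ` of `ℋ_r` on the tensor power. -/
def Xi (n r : ℕ) : DDHA r →ₐ[ℂ] Module.End ℂ (T n r) :=
  RingQuot.liftAlgHom ℂ ⟨FreeAlgebra.lift ℂ (genOp n r), genOp_rel n r⟩

/-- The finite-dimensional degenerate double Hecke algebra `D(n, r) = Ξ(ℋ_r)`. -/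
def D (n r : ℕ) : Subalgebra ℂ (Module.End ℂ (T n r)) := (Xi n r).range

/-- The set `D(n, r)^V` of all `φ ∈ D(n, r)` with `e^v ∘ φ ∘ e^{-v} = φ` for all `v ∈ V`, where
`e^v` acts through `Φ`. -/
def DV (n r : ℕ) : Set (Module.End ℂ (T n r)) :=
  {φ | φ ∈ D n r ∧ ∀ v : V n, Phi n r (enh 1 v) * φ * Phi n r (enh 1 (-v)) = φ}

end ParabolicSchur

end

open scoped TensorProduct

noncomputable section

namespace ParabolicSchur

/-! A central element `z` commutes with the torus, with all `e^v`, and lies in the algebra itself;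
these three facts force it to be a scalar. The torus acts on `T_I` by `c ^ |Iᶜ|`, so `z` can only
mix summands with equal `|I|`. The parabolic group stabilizes `V`, so elements of the algebra send
`T_I` into the sum of the `T_J` with `J ⊇ I`. A set `J ⊇ I` of the same size is `I`, hence `z`
preserves every `T_I` (`commute_summandProj`). Now `T_∅` is the line of `η^{⊗ r}`, where `z` acts by
some `c`. Applying `e^v` to a tensor in `T_I` and projecting to `T_{I ∪ {k}}` replaces the `η` at
`k` by `v`. Both operations commute with `z`, so the same `c` spreads by induction from `∅` to all
`I` (`eq_smul_one_of_commute`). -/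

/-! ### The decomposition into summands and the torus weights. -/

/-- The projection of the tensor power to the summand `T_I`, for a set `I` of positions. -/
def summandProj (n r : ℕ) (I : Finset (Fin r)) : Module.End ℂ (T n r) :=
  PiTensorProduct.map fun k => if k ∈ I then projV n else projEta n

theorem summandProj_tprod {n r : ℕ} (I : Finset (Fin r)) (f : Fin r → EV n) :
    summandProj n r I (PiTensorProduct.tprod ℂ f) =
      PiTensorProduct.tprod ℂ (fun k => (if k ∈ I then projV n else projEta n) (f k)) :=
  PiTensorProduct.map_tprod _ f

theorem Phi_tprod {n r : ℕ} (g : LinearMap.GeneralLinearGroup ℂ (EV n)) (f : Fin r → EV n) :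
    Phi n r g (PiTensorProduct.tprod ℂ f) =
      PiTensorProduct.tprod ℂ (fun k => (g : EV n →ₗ[ℂ] EV n) (f k)) :=
  PiTensorProduct.map_tprod _ f

/-- Writing each factor as its `V`-part plus its `η`-part and expanding multilinearly gives one term
per set of positions. -/
theorem sum_summandProj (n r : ℕ) : ∑ I : Finset (Fin r), summandProj n r I = 1 := by
  refine PiTensorProduct.ext (MultilinearMap.ext fun f => ?_)
  simp only [LinearMap.compMultilinearMap_apply, LinearMap.sum_apply, summandProj_tprod,
    Module.End.one_apply]
  have hf : f = (fun k => projV n (f k)) + fun k => projEta n (f k) := by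
    funext k
    simp [projV, projEta]
  conv_rhs => rw [hf, MultilinearMap.map_add_univ]
  refine Finset.sum_congr rfl fun I _ => ?_
  congr 1
  funext k
  by_cases hk : k ∈ I <;> simp [hk]

theorem torus_apply {n : ℕ} (c : ℂˣ) (x : EV n) :
    (torus n c : EV n →ₗ[ℂ] EV n) x = (x.1, (c : ℂ) * x.2) := rfl

/-- The torus acts on `T_I` by a power of `c`. -/
theorem Phi_torus_mul_summandProj {n r : ℕ} (c : ℂˣ) (I : Finset (Fin r)) :
    Phi n r (torus n c) * summandProj n r I = (c : ℂ) ^ (Iᶜ).card • summandProj n r I := by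
  refine PiTensorProduct.ext (MultilinearMap.ext fun f => ?_)
  simp only [LinearMap.compMultilinearMap_apply, Module.End.mul_apply, summandProj_tprod,
    Phi_tprod, LinearMap.smul_apply]
  have h : (fun k => (torus n c : EV n →ₗ[ℂ] EV n)
      ((if k ∈ I then projV n else projEta n) (f k))) =
      fun k => (if k ∈ I then (1 : ℂ) else c) •
        (if k ∈ I then projV n else projEta n) (f k) := by
    funext k
    by_cases hk : k ∈ I <;> simp [hk, torus_apply, projV, projEta]
  rw [h, MultilinearMap.map_smul_univ]
  congr 1
  rw [Finset.prod_ite]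
  simp only [Finset.prod_const, one_pow, one_mul]
  congr 2
  ext k
  simp

theorem summandProj_mul_Phi_torus {n r : ℕ} (c : ℂˣ) (I : Finset (Fin r)) :
    summandProj n r I * Phi n r (torus n c) = Phi n r (torus n c) * summandProj n r I := by
  refine PiTensorProduct.ext (MultilinearMap.ext fun f => ?_)
  simp only [LinearMap.compMultilinearMap_apply, Module.End.mul_apply, summandProj_tprod,
    Phi_tprod]
  congr 1
  funext k
  by_cases hk : k ∈ I <;> simp [hk, torus_apply, projV, projEta]

/-! ### Triangularity, and preservation of the summands. -/

/-- The parabolic group stabilizes `V`. -/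
theorem parabolicGroup_stabilizes {n : ℕ} {p : LinearMap.GeneralLinearGroup ℂ (EV n)}
    (hp : p ∈ parabolicGroup n) (u : V n) : ((p : EV n →ₗ[ℂ] EV n) (u, 0)).2 = 0 := by
  -- A submonoid suffices: both generating subgroups contain their inverses, so closure of the
  -- stabilizer condition under inversion need not be proved.
  let S : Submonoid (LinearMap.GeneralLinearGroup ℂ (EV n)) :=
    { carrier := {q | ∀ x : EV n, x.2 = 0 → ((q : EV n →ₗ[ℂ] EV n) x).2 = 0}
      one_mem' := fun x hx => hx
      mul_mem' := fun ha hb x hx => ha _ (hb x hx) }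
  have key : ∀ q ∈ (enhancedGroup n : Set _) ∪ ((torus n).range : Set _), q ∈ S := by
    rintro q (⟨g, v, rfl⟩ | ⟨c, rfl⟩) x hx
    · exact hx
    · rw [torus_apply, hx, mul_zero]
  have hS : p ∈ S := by
    rw [parabolicGroup, Subgroup.sup_eq_closure] at hp
    refine Subgroup.closure_induction'' (p := fun q _ => q ∈ S) key
      (fun q hq => ?_) S.one_mem (fun _ _ _ _ ha hb => S.mul_mem ha hb) hp
    rcases hq with hq | hq
    · exact key _ (Or.inl (inv_mem hq))
    · exact key _ (Or.inr (inv_mem hq))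
  exact hS (u, 0) rfl

/-- The image of a group is closed under products, so its linear span is already an algebra. Linear
conditions on the algebra can thus be tested on the operators `Φ(p)`. -/
theorem parabolicSchurAlgebra_eq_span (n r : ℕ) :
    Subalgebra.toSubmodule (parabolicSchurAlgebra n r) =
      Submodule.span ℂ (Phi n r '' (parabolicGroup n : Set _)) := by
  have h : Phi n r '' (parabolicGroup n : Set _) =
      ((parabolicGroup n).toSubmonoid.map (Phi n r) : Set (Module.End ℂ (T n r))) := rfl
  rw [parabolicSchurAlgebra, Algebra.adjoin_eq_span, h, Submonoid.closure_eq]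

/-- An element of the parabolic Schur algebra maps `T_I` to the sum of the `T_J`, `I ⊆ J`. -/
theorem summandProj_mul_mul_of_not_subset {n r : ℕ} {z : Module.End ℂ (T n r)}
    (hz : z ∈ parabolicSchurAlgebra n r) {I J : Finset (Fin r)} (hIJ : ¬ I ⊆ J) :
    summandProj n r J * z * summandProj n r I = 0 := by
  rw [← Subalgebra.mem_toSubmodule, parabolicSchurAlgebra_eq_span] at hz
  induction hz using Submodule.span_induction with
  | mem x hx =>
    obtain ⟨p, hp, rfl⟩ := hx
    -- At a position `k ∈ I \ J` the factor lies in `V`, stays there under `p`, and is killed by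
    -- `projEta`; one zero factor kills the tensor.
    obtain ⟨k, hkI, hkJ⟩ := Finset.not_subset.mp hIJ
    refine PiTensorProduct.ext (MultilinearMap.ext fun f => ?_)
    simp only [LinearMap.compMultilinearMap_apply, Module.End.mul_apply, summandProj_tprod,
      Phi_tprod, LinearMap.zero_apply]
    refine MultilinearMap.map_coord_zero _ k ?_
    simp [hkI, hkJ, projV, projEta, parabolicGroup_stabilizes hp]
  | zero => simp
  | add x y _ _ hx hy => rw [mul_add, add_mul, hx, hy, add_zero]
  | smul a x _ hx => rw [mul_smul_comm, smul_mul_assoc, hx, smul_zero]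

/-- Moving the torus element across `z` evaluates it once on `T_J` and once on `T_I`, so the block
of `z` from `T_I` to `T_J` is multiplied by two different weights with equal results. -/
theorem summandProj_mul_mul_of_card_ne {n r : ℕ} {z : Module.End ℂ (T n r)} {c : ℂˣ}
    (hz : Phi n r (torus n c) * z = z * Phi n r (torus n c)) {I J : Finset (Fin r)}
    (hIJ : (c : ℂ) ^ (Iᶜ).card ≠ (c : ℂ) ^ (Jᶜ).card) :
    summandProj n r J * z * summandProj n r I = 0 := by
  have h : (c : ℂ) ^ (Jᶜ).card • (summandProj n r J * z * summandProj n r I) =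
      (c : ℂ) ^ (Iᶜ).card • (summandProj n r J * z * summandProj n r I) := by
    rw [← mul_smul_comm ((c : ℂ) ^ (Iᶜ).card), ← smul_mul_assoc, ← smul_mul_assoc,
      ← Phi_torus_mul_summandProj, ← Phi_torus_mul_summandProj, ← summandProj_mul_Phi_torus]
    simp only [mul_assoc]
    rw [← mul_assoc z, ← hz, mul_assoc]
  have h' := congrArg (· + (-(c : ℂ) ^ (Iᶜ).card) •
    (summandProj n r J * z * summandProj n r I)) h
  simp only [← add_smul, add_neg_cancel, zero_smul] at h'
  rwa [smul_eq_zero_iff_right] at h'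
  rw [← sub_eq_add_neg]
  exact sub_ne_zero.mpr hIJ.symm

/-- An element of the parabolic Schur algebra that commutes with the torus preserves every
summand `T_I`. -/
theorem commute_summandProj {n r : ℕ} {z : Module.End ℂ (T n r)}
    (hz : z ∈ parabolicSchurAlgebra n r)
    (ht : ∀ c, Phi n r (torus n c) * z = z * Phi n r (torus n c)) (I : Finset (Fin r)) :
    z * summandProj n r I = summandProj n r I * z := by
  have key : ∀ I J : Finset (Fin r), J ≠ I →
      summandProj n r J * z * summandProj n r I = 0 := by
    intro I J hne
    by_cases hIJ : I ⊆ J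
    -- The single torus element `c = 2` separates all weights, since its powers are distinct; a
    -- strict inclusion `I ⊂ J` changes the weight.
    · refine summandProj_mul_mul_of_card_ne (ht (Units.mk0 2 two_ne_zero)) fun h => ?_
      have h' : (Iᶜ).card = (Jᶜ).card := by
        rw [Units.val_mk0] at h
        exact Nat.pow_right_injective (le_refl 2) (by exact_mod_cast h)
      have hlt := Finset.card_lt_card (hIJ.ssubset_of_ne hne.symm)
      rw [Finset.card_compl, Finset.card_compl] at h'
      have := J.card_le_univ
      omega
    · exact summandProj_mul_mul_of_not_subset hz hIJ
  calc z * summandProj n r I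
      = (∑ J, summandProj n r J) * z * summandProj n r I := by rw [sum_summandProj, one_mul]
    _ = summandProj n r I * z * summandProj n r I := by
        rw [Finset.sum_mul, Finset.sum_mul]
        exact Finset.sum_eq_single I (fun J _ h => key I J h) (by simp)
    _ = summandProj n r I * z * ∑ J, summandProj n r J := by
        rw [Finset.mul_sum]
        exact (Finset.sum_eq_single I (fun J _ h => key J I h.symm) (by simp)).symm
    _ = summandProj n r I * z := by rw [sum_summandProj, mul_one]

/-! ### Propagation of the scalar from `T_∅` by the `e^v`. -/

/-- The pure tensor in `T_I` with factors `v k` at the positions `k ∈ I` and `η` elsewhere. -/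
def etaTensor {n r : ℕ} (I : Finset (Fin r)) (v : Fin r → V n) : T n r :=
  PiTensorProduct.tprod ℂ fun k => if k ∈ I then (v k, 0) else (0, 1)

/-- The tensors `etaTensor I v` span, so an endomorphism is determined by its values on them. -/
theorem tprod_eq_sum_etaTensor {n r : ℕ} (f : Fin r → EV n) :
    PiTensorProduct.tprod ℂ f =
      ∑ I : Finset (Fin r), (∏ k, if k ∈ I then (1 : ℂ) else (f k).2) •
        etaTensor I (fun k => (f k).1) := by
  conv_lhs => rw [← Module.End.one_apply (R := ℂ) (PiTensorProduct.tprod ℂ f),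
    ← sum_summandProj, LinearMap.sum_apply]
  refine Finset.sum_congr rfl fun I _ => ?_
  rw [summandProj_tprod, etaTensor, ← MultilinearMap.map_smul_univ]
  congr 1
  funext k
  by_cases hk : k ∈ I <;> simp [hk, projV, projEta]

/-- The product of the `η`-coordinates is a linear functional on `T` with value `1` here. -/
theorem etaTensor_empty_ne_zero {n r : ℕ} (v : Fin r → V n) :
    etaTensor (∅ : Finset (Fin r)) v ≠ 0 := by
  intro h
  have := congrArg (PiTensorProduct.lift ((MultilinearMap.mkPiAlgebra ℂ (Fin r) ℂ).compLinearMap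
    fun _ => LinearMap.snd ℂ (V n) ℂ)) h
  simp [etaTensor] at this

/-- Only the `η`-coordinates survive the projection, so `T_∅` is the line of `η^{⊗ r}`; this is the
source of the scalar. -/
theorem exists_summandProj_empty {n r : ℕ} (t : T n r) :
    ∃ c : ℂ, summandProj n r ∅ t = c • etaTensor ∅ 0 := by
  induction t using PiTensorProduct.induction_on with
  | smul_tprod a f =>
    refine ⟨a * ∏ k, (f k).2, ?_⟩
    rw [map_smul, summandProj_tprod, mul_smul, etaTensor, ← MultilinearMap.map_smul_univ]
    congr 2
    funext k
    simp [projEta]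
  | add x y hx hy =>
    obtain ⟨a, ha⟩ := hx
    obtain ⟨b, hb⟩ := hy
    exact ⟨a + b, by rw [map_add, ha, hb, add_smul]⟩

/-- The map `e^{v k}` fixes the factors in `V` and turns each `η` into `v k + η`; the projection
selects `v k` at position `k` and `η` at the positions outside `insert k I`. -/
theorem summandProj_Phi_etaTensor {n r : ℕ} {I : Finset (Fin r)} {k : Fin r}
    (hk : k ∉ I) (v : Fin r → V n) :
    summandProj n r (insert k I) (Phi n r (enh 1 (v k)) (etaTensor I v)) =
      etaTensor (insert k I) v := by
  rw [etaTensor, Phi_tprod, summandProj_tprod, etaTensor]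
  congr 1
  funext j
  by_cases hj : j = k
  · subst hj
    simp [hk, enh_apply, projV]
  · by_cases hjI : j ∈ I <;> simp [hj, hjI, enh_apply, projV, projEta]

/-- An endomorphism that preserves the summands `T_I` and commutes with the `e^v` is a scalar. -/
theorem eq_smul_one_of_commute {n r : ℕ} {z : Module.End ℂ (T n r)}
    (hz : ∀ I, z * summandProj n r I = summandProj n r I * z)
    (he : ∀ v, Phi n r (enh 1 v) * z = z * Phi n r (enh 1 v)) :
    ∃ c : ℂ, z = c • 1 := by
  have hz' : ∀ I t, z (summandProj n r I t) = summandProj n r I (z t) :=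
    fun I t => LinearMap.congr_fun (hz I) t
  have he' : ∀ v t, Phi n r (enh 1 v) (z t) = z (Phi n r (enh 1 v) t) :=
    fun v t => LinearMap.congr_fun (he v) t
  obtain ⟨c, hc⟩ := exists_summandProj_empty (z (etaTensor ∅ 0))
  have h0 : summandProj n r ∅ (etaTensor ∅ 0) = etaTensor ∅ 0 := by
    rw [etaTensor, summandProj_tprod]
    simp [projEta]
  have key : ∀ (I : Finset (Fin r)) (v : Fin r → V n), z (etaTensor I v) = c • etaTensor I v := by
    intro I v
    induction I using Finset.induction_on with
    | empty =>
      have hv : etaTensor ∅ v = (etaTensor ∅ 0 : T n r) := by simp [etaTensor]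
      rw [hv, ← hc, ← hz', h0]
    | insert k I hk ih =>
      -- Since `z` commutes with the projection and with `e^{v k}`, it reaches `etaTensor I v`,
      -- where the induction hypothesis gives the same `c`.
      rw [← summandProj_Phi_etaTensor hk, hz', ← he', ih, map_smul, map_smul]
  refine ⟨c, PiTensorProduct.ext (MultilinearMap.ext fun f => ?_)⟩
  simp only [LinearMap.compMultilinearMap_apply, LinearMap.smul_apply, Module.End.one_apply]
  rw [tprod_eq_sum_etaTensor, map_sum, Finset.smul_sum]
  refine Finset.sum_congr rfl fun I _ => ?_
  rw [map_smul, key, smul_comm]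

/-- The center of the parabolic Schur algebra consists of the scalars. -/
theorem center_parabolicSchurAlgebra (n r : ℕ) :
    Subalgebra.center ℂ (parabolicSchurAlgebra n r) = ⊥ := by
  refine eq_bot_iff.mpr fun z hz => ?_
  rw [Subalgebra.mem_center_iff] at hz
  have hcomm : ∀ p ∈ parabolicGroup n,
      Phi n r p * (z : Module.End ℂ (T n r)) = z * Phi n r p := fun p hp =>
    congrArg Subtype.val
      (hz ⟨Phi n r p, Algebra.subset_adjoin (Set.mem_image_of_mem _ hp)⟩)
  obtain ⟨c, hc⟩ := eq_smul_one_of_commute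
    (commute_summandProj z.2 fun c => hcomm _ (Subgroup.mem_sup_right ⟨c, rfl⟩))
    fun v => hcomm _ (Subgroup.mem_sup_left ⟨1, v, rfl⟩)
  refine Algebra.mem_bot.mpr ⟨c, Subtype.ext ?_⟩
  rw [hc, Algebra.algebraMap_eq_smul_one]
  rfl

end ParabolicSchur

end

theorem proposition6p6 (n r : ℕ) (hr : 1 ≤ r)
    (h : ParabolicSchur.DV n r =
      (ParabolicSchur.symmetricImage n r : Set (Module.End ℂ (ParabolicSchur.T n r)))) :
    Module.finrank ℂ (Subalgebra.center ℂ (ParabolicSchur.parabolicSchurAlgebra n r)) = 1 ∧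
      Subalgebra.center ℂ (ParabolicSchur.parabolicSchurAlgebra n r) = ⊥ := by
  have hcenter := ParabolicSchur.center_parabolicSchurAlgebra n r
  -- Were `T` zero, the scalars would have dimension `0`; the vector `η^{⊗ r}` excludes this, also
  -- for `n = 0`.
  have : Nontrivial (ParabolicSchur.T n r) :=
    ⟨⟨_, 0, ParabolicSchur.etaTensor_empty_ne_zero 0⟩⟩
  refine ⟨?_, hcenter⟩
  rw [hcenter]
  have e := Algebra.botEquivOfInjective (R := ℂ)
    (A := ParabolicSchur.parabolicSchurAlgebra n r) (algebraMap ℂ _).injective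
  rw [e.toLinearEquiv.finrank_eq, Module.finrank_self]
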